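/- Let $G$ be a finite map on a closed connected orientable surface (a connected graph, loops and multiple edges allowed, embedded such that every face is an open disk), with a fixed reference orientation of its edges. A set of directed edges is identified with its characteristic flow in $\mathbb{Z}^{E}$ ($+1$ for each forward and $-1$ for each backward directed edge). For a face $f$ let $\phi(f)\in\mathbb{Z}^E$ be the characteristic flow of its counterclockwise facial walk, and let $\mathbb{F}\subseteq\mathbb{Z}^E$ be the subgroup generated by all $\phi(f)$. Two orientations $D,D'$ of $G$ are homologous if $D-D'\in\mathbb{F}$. Let $D_0$ be an orientation of $G$ and let $O(G,D_0)$ be the set of the orientations of $G$ homologous to $D_0$. An edge is rigid if it has the same orientation in all elements of $O(G,D_0)$; let $\widetilde G$ be the embedded graph obtained from $G$ by deleting the rigid edges. For a face $\widetilde f$ of $\widetilde G$ let $\partial\widetilde f$ be its boundary considered counterclockwise, i.e. the set of the edges of $\widetilde G$ incident to $\widetilde f$, each directed so that $\widetilde f$ is on its left. For orientations $D,D'$ let $D\setminus D'$ be the set of the edges of $D$ that are oriented differently in $D'$, with their direction in $D$. (1) For every face $\widetilde f$ of $\widetilde G$ there is $D\in O(G,D_0)$ such that $\partial\widetilde f$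 is an oriented subgraph of $D$. (2) Consequently the face flips form a minimal generating set of the lattice, in the following sense. Let $f_0$ be any face of $G$, and write $D\le_{f_0}D'$ if $D\setminus D'=\sum_{f\ne f_0}c_f\,\phi(f)$ for some coefficients $c_f\in\mathbb{N}$ (including $0$), the sum being over the faces $f\neq f_0$ of $G$. Then $(O(G,D_0),\le_{f_0})$ is a distributive lattice. Let $\widetilde{\mathcal F}'$ be the set of the faces of $\widetilde G$ other than the one that contains $f_0$. For $S\subseteq\widetilde{\mathcal F}'$, an $S$-flip leads from $D\in O(G,D_0)$ to $D'\in O(G,D_0)$ if $D\setminus D'=\partial\widetilde f$ for some $\widetilde f\in S$. Then for all $D,D'\in O(G,D_0)$ we have $D\le_{f_0}D'$ if and only if $D'$ can be reached from $D$ by a finite (possibly empty) sequence of $\widetilde{\mathcal F}'$-flips; in particular any two elements of $O(G,D_0)$ are linked by $\widetilde{\mathcal F}'$-flips and their inverses. Moreover $\widetilde{\mathcal F}'$ is minimal with respect to inclusion for each of these two properties: no proper subset $S$ of it has the property that $\le_{f_0}$ is reachability by $S$-flips, and for no proper subset $S$ are any two elements of $O(G,D_0)$ linked by $S$-flips and their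 inverses. -/

import Mathlib

/-- A dart over a set `E` of edges: an edge together with a direction of traversal. Every edge
carries a fixed reference orientation; `(e, true)` traverses `e` forward and `(e, false)`
traverses `e` backward. -/
abbrev Dart (E : Type*) : Type _ := E × Bool

/-- Reversal of darts. -/
def Dart.rev {E : Type*} : Equiv.Perm (Dart E) :=
  Equiv.prodCongr (Equiv.refl E) Equiv.boolNot

/-- A map on a closed connected orientable surface with vertices `V`, edges `E` and faces `F` (a
connected graph embedded such that all faces are open disks), given by its rotation system.
Loops and multiple edges are allowed. -/
structure SurfaceMap (V E F : Type*) where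
  /-- The next dart in counterclockwise order around the start vertex of a dart. -/
  rot : Equiv.Perm (Dart E)
  /-- The start vertex of a dart. -/
  tail : Dart E → V
  /-- The face on the left of a dart. -/
  left : Dart E → F
  /-- The vertices are the orbits of the rotation. -/
  tail_eq_iff : ∀ d d', tail d = tail d' ↔ rot.SameCycle d d'
  /-- The faces are the orbits of the permutation that sends a dart `d` to the next dart along
  the boundary of the face on the left of `d`: at the end of `d`, it is the dart that precedes
  the reversal of `d` in counterclockwise order. -/
  left_eq_iff : ∀ d d', left d = left d' ↔ (rot⁻¹ * Dart.rev).SameCycle d d'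
  nonempty_vertices : Nonempty V
  /-- The graph is connected. -/
  connected : ∀ v w : V,
    Relation.ReflTransGen (fun a b => ∃ d, tail d = a ∧ tail (Dart.rev d) = b) v w
  /-- Every face has a dart on its boundary, unless there is no edge at all. -/
  left_surjective : Nonempty E → Function.Surjective left
  /-- The map without edges is a single vertex on the sphere; it has exactly one face. -/
  unique_face : IsEmpty E → Nonempty (Unique F)

/-- An orientation of the edges: it chooses one of the two darts of each edge. -/
structure EdgeOrientation (E : Type*) where
  /-- `dir e = true` means that `e` is oriented as in the reference orientation. -/
  dir : E → Bool

namespace EdgeOrientation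

variable {E : Type*}

/-- The darts of an orientation (the orientation as an oriented subgraph). -/
def arcs (D : EdgeOrientation E) : Set (Dart E) := {d | D.dir d.1 = d.2}

/-- The oriented subgraph `D \ D'` of `D` formed by the edges that are not oriented as in `D'`. -/
def diff (D D' : EdgeOrientation E) : Set (Dart E) := D.arcs \ D'.arcs

end EdgeOrientation

open Classical in
/-- The characteristic flow of a set of darts: the number of times an edge is traversed forward
minus the number of times it is traversed backward. -/
noncomputable def charFlow {E : Type*} (T : Set (Dart E)) : E → ℤ := fun e =>
  (if (e, true) ∈ T then 1 else 0) - (if (e, false) ∈ T then 1 else 0)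

namespace SurfaceMap

variable {V E F : Type*} (G : SurfaceMap V E F)

/-- The characteristic flow of the counterclockwise facial walk of the face `f`. This walk
traverses every dart with `f` on its left exactly once. -/
noncomputable def facialFlow (f : F) : E → ℤ := charFlow {d | G.left d = f}

/-- The subgroup of `ℤ^E` generated by the facial walks. -/
def faceGroup : AddSubgroup (E → ℤ) := AddSubgroup.closure (Set.range G.facialFlow)

/-- Two flows are homologous if they differ by an element of the group of the facial walks. -/
def Homologous (φ φ' : E → ℤ) : Prop := φ - φ' ∈ G.faceGroup

/-- The set of all orientations that are homologous to `D₀`. -/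
def homologyClass (D₀ : EdgeOrientation E) : Set (EdgeOrientation E) :=
  {D | G.Homologous (charFlow D.arcs) (charFlow D₀.arcs)}

/-- An edge is rigid if it has the same orientation in all orientations homologous to `D₀`. -/
def Rigid (D₀ : EdgeOrientation E) (e : E) : Prop :=
  ∀ D ∈ G.homologyClass D₀, ∀ D' ∈ G.homologyClass D₀, D.dir e = D'.dir e

/-- Two faces are merged in one step by the deletion of the rigid edges if they lie on the two
sides of a rigid edge. -/
def MergeStep (D₀ : EdgeOrientation E) (f f' : F) : Prop :=
  ∃ d : Dart E, G.Rigid D₀ d.1 ∧ G.left d = f ∧ G.left (Dart.rev d) = f'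

/-- The faces of the reduced graph, obtained from `G` by the deletion of the rigid edges: a face of
the reduced graph is a class of faces of `G` for the equivalence relation generated by
`MergeStep` (it need not be a disk). -/
def ReducedFace (D₀ : EdgeOrientation E) : Type _ := Quot (G.MergeStep D₀)

/-- The face of the reduced graph that contains the face `f` of `G`. -/
def reducedFace (D₀ : EdgeOrientation E) (f : F) : G.ReducedFace D₀ := Quot.mk _ f

/-- The boundary of a face of the reduced graph, considered counterclockwise: the darts of the
reduced graph that have this face on their left. -/
def reducedBoundary (D₀ : EdgeOrientation E) (x : G.ReducedFace D₀) : Set (Dart E) :=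
  {d | ¬ G.Rigid D₀ d.1 ∧ G.reducedFace D₀ (G.left d) = x}

/-- A set of darts is counterclockwise with respect to `f₀` if its characteristic flow is a
combination, with coefficients in `ℕ`, of the facial walks of the faces other than `f₀`. -/
def IsCounterclockwise [Fintype F] (f₀ : F) (T : Set (Dart E)) : Prop :=
  ∃ c : F → ℕ, c f₀ = 0 ∧ charFlow T = ∑ f, c f • G.facialFlow f

/-- The order on orientations defined by the face `f₀`. -/
def OrientationLE [Fintype F] (f₀ : F) (D D' : EdgeOrientation E) : Prop :=
  G.IsCounterclockwise f₀ (D.diff D')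

/-- The faces of the reduced graph other than the one that contains `f₀`: these index the face
flips. -/
def flipFaces (D₀ : EdgeOrientation E) (f₀ : F) : Set (G.ReducedFace D₀) :=
  {x | x ≠ G.reducedFace D₀ f₀}

/-- There is a flip with label in `S` from `D` to `D'`: the boundary of some face in `S` is an
oriented subgraph of `D`, and `D'` is obtained from `D` by the reversal of this boundary. -/
def Flip (D₀ : EdgeOrientation E) (S : Set (G.ReducedFace D₀)) (D D' : G.homologyClass D₀) : Prop :=
  ∃ x ∈ S, D.1.diff D'.1 = G.reducedBoundary D₀ x

/-- The flips with labels in `S` generate the order on the orientations homologous to `D₀`: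
`D ≤ D'` if and only if `D'` is reached from `D` by a sequence of such flips. -/
def Generates [Fintype F] (D₀ : EdgeOrientation E) (f₀ : F) (S : Set (G.ReducedFace D₀)) : Prop :=
  ∀ D D' : G.homologyClass D₀,
    G.OrientationLE f₀ D.1 D'.1 ↔ Relation.ReflTransGen (G.Flip D₀ S) D D'

/-- Any two orientations homologous to `D₀` are linked by a sequence of flips and inverse flips
with labels in `S`. -/
def Connects (D₀ : EdgeOrientation E) (S : Set (G.ReducedFace D₀)) : Prop :=
  ∀ D D' : G.homologyClass D₀, Relation.EqvGen (G.Flip D₀ S) D D'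

end SurfaceMap

/-! Integer combinations of facial walks are coboundaries of potentials on the faces. The dual graph
is connected, so a potential is determined by its coboundary and its value at `f₀`. Each orientation
`D` homologous to `D₀` thus has a unique height, vanishing at `f₀`, whose coboundary is the flow of
`D₀ \ D`, and `≤_{f₀}` is the pointwise order of heights (`orientationLE_iff`). Along an arc of `D`,
the height difference to any `D'` drops by 0 or 1 from left to right; truncation preserves this, so
the heights form a sublattice of `ℤ^F`.

Height differences are constant on faces of the reduced graph, and a flip adds the indicator of such
a face. An orientation of maximal height, normalized at a face in `x`, contains the boundary of `x`,
which gives (1). Below any `D'` a legal flip is found by an extremal choice of face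
(`exists_flip_le`). Minimality holds because only flips at `x` change heights inside `x`, and by (1)
such a flip occurs. -/

@[simp]
theorem Dart.rev_rev {E : Type*} (d : Dart E) : Dart.rev (Dart.rev d) = d := by
  simp [Dart.rev, Prod.map]

namespace EdgeOrientation

variable {E : Type*}

theorem mem_arcs {D : EdgeOrientation E} {d : Dart E} : d ∈ D.arcs ↔ D.dir d.1 = d.2 := Iff.rfl

theorem rev_mem_arcs_iff {D : EdgeOrientation E} {d : Dart E} :
    Dart.rev d ∈ D.arcs ↔ d ∉ D.arcs := by
  obtain ⟨e, b⟩ := d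
  simp only [mem_arcs, Dart.rev, Equiv.prodCongr_apply, Prod.map, Equiv.refl_apply,
    Equiv.boolNot_apply]
  cases b <;> cases D.dir e <;> simp

theorem mem_arcs_iff_of_dir_eq {D D' : EdgeOrientation E} {d : Dart E}
    (h : D.dir d.1 = D'.dir d.1) : d ∈ D.arcs ↔ d ∈ D'.arcs := by
  rw [mem_arcs, mem_arcs, h]

theorem dir_injective : Function.Injective (dir : EdgeOrientation E → E → Bool) := by
  rintro ⟨a⟩ ⟨b⟩ h
  exact congrArg _ h

instance [Finite E] : Finite (EdgeOrientation E) := Finite.of_injective _ dir_injective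

theorem charFlow_arcs (D : EdgeOrientation E) (e : E) :
    charFlow D.arcs e = if D.dir e = true then 1 else -1 := by
  cases h : D.dir e <;> simp [charFlow, arcs, h]

theorem charFlow_diff (D D' : EdgeOrientation E) (e : E) :
    2 * charFlow (D.diff D') e = charFlow D.arcs e - charFlow D'.arcs e := by
  cases h : D.dir e <;> cases h' : D'.dir e <;> simp [charFlow, diff, arcs, h, h']

end EdgeOrientation

/-! ### Potentials on the faces and connectedness of the dual graph -/

namespace SurfaceMap

open EdgeOrientation

variable {V E F : Type*} (G : SurfaceMap V E F)

/-- The coboundary of a potential on the faces. -/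
def coboundary (c : F → ℤ) : E → ℤ := fun e => c (G.left (e, true)) - c (G.left (e, false))

/-- Each edge is traversed forward by the walk of the face on its left and backward by that of the
face on its right. -/
theorem sum_smul_facialFlow [Fintype F] (c : F → ℤ) :
    ∑ f, c f • G.facialFlow f = G.coboundary c := by
  classical
  ext e
  simp [facialFlow, charFlow, coboundary, Finset.sum_apply, mul_sub, Finset.sum_sub_distrib]

theorem mem_faceGroup_iff [Fintype F] {ψ : E → ℤ} :
    ψ ∈ G.faceGroup ↔ ∃ c, ψ = G.coboundary c := by
  classical
  constructor
  · intro h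
    induction h using AddSubgroup.closure_induction with
    | mem x hx =>
      obtain ⟨f, rfl⟩ := hx
      exact ⟨Pi.single f 1, by simp [← sum_smul_facialFlow, Pi.single_apply]⟩
    | zero => exact ⟨0, by ext; simp [coboundary]⟩
    | add x y _ _ hx hy =>
      obtain ⟨a, rfl⟩ := hx
      obtain ⟨b, rfl⟩ := hy
      exact ⟨a + b, by ext; simp [coboundary]; ring⟩
    | neg x _ hx =>
      obtain ⟨a, rfl⟩ := hx
      exact ⟨-a, by ext; simp [coboundary]; ring⟩
  · rintro ⟨c, rfl⟩
    rw [← sum_smul_facialFlow]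
    exact sum_mem fun f _ => zsmul_mem (AddSubgroup.subset_closure (Set.mem_range_self f)) _

/-- A function on the faces that has the same value on both sides of every edge is constant:
the dual graph is connected. -/
theorem eq_of_forall_left_rev {α : Type*} (c : F → α)
    (hc : ∀ d, c (G.left (Dart.rev d)) = c (G.left d)) (f f' : F) : c f = c f' := by
  rcases isEmpty_or_nonempty E with hE | hE
  · obtain ⟨u⟩ := G.unique_face hE
    rw [u.eq_default f, u.eq_default f']
  have hrot : ∀ d, c (G.left (G.rot d)) = c (G.left d) := fun d => by
    -- The face permutation sends the reversal of `rot d` to `d` in one step.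
    have h : G.left (Dart.rev (G.rot d)) = G.left d :=
      (G.left_eq_iff _ _).2 ⟨1, by simp⟩
    rw [← hc, h]
  have hpow : ∀ d (n : ℤ), c (G.left ((G.rot ^ n) d)) = c (G.left d) := fun d n => by
    induction n with
    | zero => simp
    | succ n ih => rw [add_comm, zpow_add, zpow_one, Equiv.Perm.mul_apply, hrot, ih]
    | pred n ih =>
      rw [← ih, ← hrot ((G.rot ^ (-(n : ℤ) - 1)) d), ← Equiv.Perm.mul_apply, ← zpow_one_add,
        add_sub_cancel]
  have htail : ∀ d d', G.tail d = G.tail d' → c (G.left d) = c (G.left d') := fun d d' h => by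
    obtain ⟨n, rfl⟩ := (G.tail_eq_iff d d').1 h
    exact (hpow d n).symm
  obtain ⟨d, rfl⟩ := G.left_surjective hE f
  obtain ⟨d', rfl⟩ := G.left_surjective hE f'
  -- The value is constant around each vertex and across each edge, so it propagates along paths of
  -- the graph.
  have key : ∀ w, Relation.ReflTransGen
      (fun a b => ∃ d, G.tail d = a ∧ G.tail (Dart.rev d) = b) (G.tail d) w →
      ∀ d', G.tail d' = w → c (G.left d) = c (G.left d') := fun w hw => by
    induction hw with
    | refl => exact fun d' h => htail _ _ h.symm
    | tail _ h ih =>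
      obtain ⟨a, ha, ha'⟩ := h
      intro d' hd'
      rw [ih a ha, ← hc, htail _ _ (ha'.trans hd'.symm)]
  exact key _ (G.connected _ _) d' rfl

theorem coboundary_injOn {f₀ : F} {c c' : F → ℤ} (h₀ : c f₀ = c' f₀)
    (h : G.coboundary c = G.coboundary c') : c = c' := by
  ext f
  have := G.eq_of_forall_left_rev (fun f => c f - c' f) (fun ⟨e, b⟩ => by
    have := congrFun h e
    simp only [coboundary] at this
    cases b <;> simp [Dart.rev] <;> linarith) f f₀
  linarith

theorem even_of_even_coboundary {f₀ : F} {c : F → ℤ} (h₀ : c f₀ = 0)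
    (h : ∀ e, Even (G.coboundary c e)) (f : F) : Even (c f) := by
  have := G.eq_of_forall_left_rev (fun f => Even (c f)) (fun ⟨e, b⟩ => by
    have := h e
    simp only [coboundary, Int.even_sub] at this
    cases b <;> simp [Dart.rev, this]) f f₀
  rw [this, h₀]
  exact Even.zero

theorem reducedFace_left_eq_of_rigid (D₀ : EdgeOrientation E) {d : Dart E} (hd : G.Rigid D₀ d.1) :
    G.reducedFace D₀ (G.left d) = G.reducedFace D₀ (G.left (Dart.rev d)) :=
  Quot.sound ⟨d, hd, rfl, rfl⟩

theorem exists_dir_ne_of_not_rigid {D₀ : EdgeOrientation E} (D : G.homologyClass D₀) {e : E} (he : ¬ G.Rigid D₀ e) :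
    ∃ D' : G.homologyClass D₀, D'.1.dir e ≠ D.1.dir e := by
  by_contra! h
  exact he fun A hA B hB => (h ⟨A, hA⟩).trans (h ⟨B, hB⟩).symm

open Classical in
/-- The indicator function of a face of the reduced graph. -/
noncomputable def indicator {D₀ : EdgeOrientation E} (x : G.ReducedFace D₀) (f : F) : ℤ :=
  if G.reducedFace D₀ f = x then 1 else 0

theorem indicator_reducedFace {D₀ : EdgeOrientation E} (f : F) : G.indicator (G.reducedFace D₀ f) f = 1 := if_pos rfl

theorem indicator_nonneg {D₀ : EdgeOrientation E} (x : G.ReducedFace D₀) : 0 ≤ G.indicator x := fun f => by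
  simp only [indicator, Pi.zero_apply]
  split_ifs <;> simp

theorem charFlow_reducedBoundary {D₀ : EdgeOrientation E} (x : G.ReducedFace D₀) :
    charFlow (G.reducedBoundary D₀ x) = G.coboundary (G.indicator x) := by
  ext e
  by_cases he : G.Rigid D₀ e
  · have h : G.reducedFace D₀ (G.left (e, true)) = G.reducedFace D₀ (G.left (e, false)) :=
      G.reducedFace_left_eq_of_rigid D₀ (d := (e, true)) he
    by_cases hl : G.reducedFace D₀ (G.left (e, false)) = x <;>
      simp [charFlow, reducedBoundary, coboundary, indicator, he, h, hl]
  · by_cases hl : G.reducedFace D₀ (G.left (e, true)) = x <;>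
      by_cases hr : G.reducedFace D₀ (G.left (e, false)) = x <;>
      simp [charFlow, reducedBoundary, coboundary, indicator, he, hl, hr]

/-! ### Heights and the distributive lattice -/

section Height

variable [Fintype F] {D₀ : EdgeOrientation E} (f₀ : F)

theorem exists_height (D : G.homologyClass D₀) :
    ∃ h : F → ℤ, h f₀ = 0 ∧
      ∀ e, charFlow D₀.arcs e - charFlow D.1.arcs e = 2 * G.coboundary h e := by
  -- The coboundary of `c` is twice a flow, so parity of `c` is constant over the faces; `c f₀ - c`
  -- can be halved.
  obtain ⟨c, hc⟩ := G.mem_faceGroup_iff.1 D.2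
  have hce : ∀ e, charFlow D.1.arcs e - charFlow D₀.arcs e = G.coboundary c e := congrFun hc
  have hev : ∀ f, Even (c f₀ - c f) := by
    refine G.even_of_even_coboundary (f₀ := f₀) (c := fun f => c f₀ - c f) (sub_self _) fun e => ?_
    have h : G.coboundary (fun f => c f₀ - c f) e = - G.coboundary c e := by
      simp [coboundary]
    rw [h, ← hce, ← charFlow_diff, even_neg]
    exact even_two_mul _
  choose h hh using hev
  refine ⟨h, by have := hh f₀; omega, fun e => ?_⟩
  have h1 := hh (G.left (e, true))
  have h2 := hh (G.left (e, false))
  have h3 := hce e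
  simp only [coboundary] at h3 ⊢
  linarith

/-- The potential, normalized at `f₀`, whose coboundary is the flow of the difference between `D₀`
and `D`. -/
noncomputable def height (D : G.homologyClass D₀) : F → ℤ := (G.exists_height f₀ D).choose

@[simp]
theorem height_base (D : G.homologyClass D₀) : G.height f₀ D f₀ = 0 :=
  (G.exists_height f₀ D).choose_spec.1

theorem coboundary_height (D : G.homologyClass D₀) (e : E) :
    charFlow D₀.arcs e - charFlow D.1.arcs e = 2 * G.coboundary (G.height f₀ D) e :=
  (G.exists_height f₀ D).choose_spec.2 e

theorem charFlow_diff_eq (D D' : G.homologyClass D₀) :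
    charFlow (D.1.diff D'.1) = G.coboundary (G.height f₀ D' - G.height f₀ D) := by
  ext e
  have h := charFlow_diff D.1 D'.1 e
  have h1 := G.coboundary_height f₀ D e
  have h2 := G.coboundary_height f₀ D' e
  simp only [coboundary, Pi.sub_apply] at *
  linarith

theorem height_injective : Function.Injective (G.height f₀ (D₀ := D₀)) := by
  intro D D' h
  ext1
  apply dir_injective
  ext1 e
  have h1 := G.coboundary_height f₀ D e
  have h2 := G.coboundary_height f₀ D' e
  rw [← h, ← h1, charFlow_arcs D.1, charFlow_arcs D'.1] at h2
  cases hD : D.1.dir e <;> cases hD' : D'.1.dir e <;> simp [hD, hD'] at h2 ⊢ <;> linarith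

variable {f₀} in
-- By uniqueness of potentials, the coefficients of the facial walks can only be the height
-- differences.
theorem orientationLE_iff {D D' : G.homologyClass D₀} :
    G.OrientationLE f₀ D.1 D'.1 ↔ G.height f₀ D ≤ G.height f₀ D' := by
  constructor
  · rintro ⟨c, hc₀, hc⟩
    have hc' : charFlow (D.1.diff D'.1) = G.coboundary fun f => (c f : ℤ) := by
      rw [hc, ← sum_smul_facialFlow]
      simp
    rw [G.charFlow_diff_eq f₀] at hc'
    have := G.coboundary_injOn (f₀ := f₀) (by simp [height_base, hc₀]) hc'
    intro f
    have h : G.height f₀ D' f - G.height f₀ D f = c f := congrFun this f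
    exact sub_nonneg.1 (h ▸ Int.natCast_nonneg _)
  · intro h
    refine ⟨fun f => (G.height f₀ D' f - G.height f₀ D f).toNat, by simp [height_base], ?_⟩
    rw [G.charFlow_diff_eq f₀, ← sum_smul_facialFlow]
    refine Finset.sum_congr rfl fun f _ => ?_
    rw [← natCast_zsmul, Int.toNat_of_nonneg (sub_nonneg.2 (h f))]
    rfl

/-- Along an arc of `D` that is reversed in `D'`, the difference of the heights drops by one from
left to right; along an arc common to `D` and `D'`, it is constant. -/
theorem height_sub_left (D D' : G.homologyClass D₀) {d : Dart E} (hd : d ∈ D.1.arcs) :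
    (d ∈ D'.1.arcs ∧ G.height f₀ D' (G.left d) - G.height f₀ D (G.left d) =
      G.height f₀ D' (G.left (Dart.rev d)) - G.height f₀ D (G.left (Dart.rev d))) ∨
    (d ∉ D'.1.arcs ∧ G.height f₀ D' (G.left d) - G.height f₀ D (G.left d) =
      G.height f₀ D' (G.left (Dart.rev d)) - G.height f₀ D (G.left (Dart.rev d)) + 1) := by
  obtain ⟨e, b⟩ := d
  have h := congrFun (G.charFlow_diff_eq f₀ D D') e
  simp only [mem_arcs] at hd
  simp only [charFlow, diff, Set.mem_sdiff, mem_arcs, hd, coboundary, Pi.sub_apply] at h ⊢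
  cases b <;> cases h' : D'.1.dir e <;> simp [Dart.rev, h'] at h ⊢ <;> linarith

/-- Reversing exactly the arcs along which `p` drops changes the height by `p`. -/
theorem exists_height_eq_add (D : G.homologyClass D₀) {p : F → ℤ} (hp₀ : p f₀ = 0)
    (hp : ∀ d ∈ D.1.arcs, p (G.left d) = p (G.left (Dart.rev d)) ∨
      p (G.left d) = p (G.left (Dart.rev d)) + 1) :
    ∃ D' : G.homologyClass D₀, G.height f₀ D' = G.height f₀ D + p := by
  classical
  let D' : EdgeOrientation E :=
    ⟨fun e => if p (G.left (e, true)) = p (G.left (e, false)) then D.1.dir e else !D.1.dir e⟩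
  have key : ∀ e, charFlow D.1.arcs e - charFlow D'.arcs e = 2 * G.coboundary p e := by
    intro e
    have h := hp (e, D.1.dir e) rfl
    rw [charFlow_arcs, charFlow_arcs]
    simp only [coboundary, D']
    obtain hD | hD := Bool.eq_false_or_eq_true (D.1.dir e) <;> rw [hD] at h <;>
      simp only [Dart.rev, Equiv.prodCongr_apply, Prod.map, Equiv.refl_apply,
        Equiv.boolNot_apply, Bool.not_true, Bool.not_false] at h <;>
      rcases h with h | h <;> simp [h, hD]
  have hD₀ : ∀ e, charFlow D₀.arcs e - charFlow D'.arcs e =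
      2 * G.coboundary (G.height f₀ D + p) e := by
    intro e
    have h := key e
    have h1 := G.coboundary_height f₀ D e
    simp only [coboundary, Pi.add_apply] at *
    linarith
  have hD' : D' ∈ G.homologyClass D₀ := by
    refine G.mem_faceGroup_iff.2 ⟨-(2 * (G.height f₀ D + p)), ?_⟩
    ext e
    have h := hD₀ e
    simp only [coboundary, Pi.add_apply, Pi.neg_apply, Pi.sub_apply, Pi.mul_apply,
      Pi.ofNat_apply] at *
    linarith
  refine ⟨⟨D', hD'⟩, G.coboundary_injOn (f₀ := f₀) (by simp [height_base, hp₀]) ?_⟩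
  ext e
  have h := G.coboundary_height f₀ ⟨D', hD'⟩ e
  rw [hD₀ e] at h
  linarith

/-- A drop of 0 or 1 remains so after truncating the height difference at 0. -/
theorem exists_height_eq_sup (D D' : G.homologyClass D₀) :
    ∃ D'' : G.homologyClass D₀, G.height f₀ D'' = G.height f₀ D ⊔ G.height f₀ D' := by
  obtain ⟨D'', h⟩ := G.exists_height_eq_add f₀ D
    (p := fun f => max (G.height f₀ D' f - G.height f₀ D f) 0) (by simp [height_base])
    (fun d hd => by
      have := G.height_sub_left f₀ D D' hd
      omega)
  refine ⟨D'', h.trans ?_⟩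
  ext f
  simp only [Pi.add_apply, Pi.sup_apply]
  omega

theorem exists_height_eq_inf (D D' : G.homologyClass D₀) :
    ∃ D'' : G.homologyClass D₀, G.height f₀ D'' = G.height f₀ D ⊓ G.height f₀ D' := by
  obtain ⟨D'', h⟩ := G.exists_height_eq_add f₀ D
    (p := fun f => min (G.height f₀ D' f - G.height f₀ D f) 0) (by simp [height_base])
    (fun d hd => by
      have := G.height_sub_left f₀ D D' hd
      omega)
  refine ⟨D'', h.trans ?_⟩
  ext f
  simp only [Pi.add_apply, Pi.inf_apply]
  omega

theorem exists_distribLattice :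
    ∃ _ : DistribLattice (G.homologyClass D₀),
      ∀ D D' : G.homologyClass D₀, D ≤ D' ↔ G.OrientationLE f₀ D.1 D'.1 := by
  choose s hs using G.exists_height_eq_sup f₀ (D₀ := D₀)
  choose i hi using G.exists_height_eq_inf f₀ (D₀ := D₀)
  let _ : Max (G.homologyClass D₀) := ⟨s⟩
  let _ : Min (G.homologyClass D₀) := ⟨i⟩
  let _ : PartialOrder (G.homologyClass D₀) :=
    PartialOrder.lift (G.height f₀) (G.height_injective f₀)
  exact ⟨Function.Injective.distribLattice (G.height f₀) (G.height_injective f₀) Iff.rfl Iff.rfl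
    hs hi, fun D D' => G.orientationLE_iff.symm⟩

/-! ### Rigid edges and flips as indicator functions -/

variable {f₀}

theorem height_sub_left_of_rigid (D D' : G.homologyClass D₀) {d : Dart E}
    (hd : G.Rigid D₀ d.1) :
    G.height f₀ D' (G.left d) - G.height f₀ D (G.left d) =
      G.height f₀ D' (G.left (Dart.rev d)) - G.height f₀ D (G.left (Dart.rev d)) := by
  have hdir := hd D.1 D.2 D'.1 D'.2
  by_cases h : d ∈ D.1.arcs
  · have h' := (mem_arcs_iff_of_dir_eq hdir).1 h
    have := G.height_sub_left f₀ D D' h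
    tauto
  · have h' := mt (mem_arcs_iff_of_dir_eq hdir).2 h
    rw [← rev_mem_arcs_iff] at h h'
    have := G.height_sub_left f₀ D D' h
    rw [Dart.rev_rev] at this
    rcases this with this | this
    · exact this.2.symm
    · tauto

theorem height_sub_eq_of_reducedFace_eq (D D' : G.homologyClass D₀) {f f' : F}
    (h : G.reducedFace D₀ f = G.reducedFace D₀ f') :
    G.height f₀ D' f - G.height f₀ D f = G.height f₀ D' f' - G.height f₀ D f' := by
  induction Quot.eqvGen_exact h with
  | rel x y hxy =>
    obtain ⟨d, hd, rfl, rfl⟩ := hxy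
    exact G.height_sub_left_of_rigid D D' hd
  | refl => rfl
  | symm x y hxy ih => exact (ih (Quot.eqvGen_sound hxy)).symm
  | trans x y z hxy hyz ih ih' =>
    exact (ih (Quot.eqvGen_sound hxy)).trans (ih' (Quot.eqvGen_sound hyz))

/-- An edge that is not rigid has distinct faces of the reduced graph on its two sides. -/
theorem reducedFace_left_ne_of_not_rigid (f₀ : F) (D : G.homologyClass D₀) {d : Dart E}
    (hD : d ∈ D.1.arcs) (hd : ¬ G.Rigid D₀ d.1) :
    G.reducedFace D₀ (G.left d) ≠ G.reducedFace D₀ (G.left (Dart.rev d)) := by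
  intro h
  obtain ⟨D', hD'⟩ := G.exists_dir_ne_of_not_rigid D hd
  have h1 := G.height_sub_eq_of_reducedFace_eq (f₀ := f₀) D D' h
  have h2 : d ∉ D'.1.arcs := fun h => hD' (h.trans hD.symm)
  rcases G.height_sub_left f₀ D D' hD with h3 | h3
  · exact h2 h3.1
  · omega

theorem height_eq_add_indicator {x : G.ReducedFace D₀} (hx : x ≠ G.reducedFace D₀ f₀)
    {D D' : G.homologyClass D₀} (h : D.1.diff D'.1 = G.reducedBoundary D₀ x) :
    G.height f₀ D' = G.height f₀ D + G.indicator x := by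
  have h1 := G.charFlow_diff_eq f₀ D D'
  rw [h, charFlow_reducedBoundary] at h1
  rw [G.coboundary_injOn (f₀ := f₀) (by simp [height_base, indicator, hx.symm]) h1]
  simp

theorem diff_eq_reducedBoundary {x : G.ReducedFace D₀} {D D' : G.homologyClass D₀}
    (h : G.height f₀ D' = G.height f₀ D + G.indicator x) :
    D.1.diff D'.1 = G.reducedBoundary D₀ x := by
  have hi : ∀ f, G.height f₀ D' f - G.height f₀ D f = G.indicator x f := by simp [h]
  ext d
  constructor
  · rintro ⟨hd, hd'⟩
    have h1 := G.height_sub_left f₀ D D' hd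
    refine ⟨fun hr => hd' ((mem_arcs_iff_of_dir_eq (hr D.1 D.2 D'.1 D'.2)).1 hd), ?_⟩
    rw [hi, hi] at h1
    by_contra hne
    simp only [hd', false_and, false_or, not_false_eq_true, true_and, indicator, hne,
      if_false] at h1
    split_ifs at h1 <;> omega
  · rintro ⟨hr, hx⟩
    by_cases hd : d ∈ D.1.arcs
    · refine ⟨hd, fun hd' => ?_⟩
      have hne := G.reducedFace_left_ne_of_not_rigid f₀ D hd hr
      have h1 := G.height_sub_left f₀ D D' hd
      rw [hx] at hne
      rw [hi, hi] at h1
      simp [hd', indicator, hx, hne.symm] at h1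
    · have hd' := rev_mem_arcs_iff.2 hd
      have hne := G.reducedFace_left_ne_of_not_rigid f₀ D hd' hr
      have h1 := G.height_sub_left f₀ D D' hd'
      rw [Dart.rev_rev, hx] at hne
      rw [hi, hi, Dart.rev_rev] at h1
      simp [indicator, hx, hne] at h1

theorem exists_flip {x : G.ReducedFace D₀} (hx : x ≠ G.reducedFace D₀ f₀)
    {D : G.homologyClass D₀} (h : G.reducedBoundary D₀ x ⊆ D.1.arcs) :
    ∃ D' : G.homologyClass D₀, G.height f₀ D' = G.height f₀ D + G.indicator x := by
  refine G.exists_height_eq_add f₀ D (by simp [indicator, hx.symm]) fun d hd => ?_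
  by_cases hl : G.reducedFace D₀ (G.left d) = x
  · by_cases hr : G.reducedFace D₀ (G.left (Dart.rev d)) = x <;> simp [indicator, hl, hr]
  · by_cases hr : G.reducedFace D₀ (G.left (Dart.rev d)) = x
    · have hrig : ¬ G.Rigid D₀ d.1 := fun hrig =>
        hl ((G.reducedFace_left_eq_of_rigid D₀ hrig).trans hr)
      exact absurd hd (rev_mem_arcs_iff.1 (h ⟨hrig, hr⟩))
    · simp [indicator, hl, hr]

/-- Flips with labels in `S` do not change the height of a face outside the members of `S`. -/
theorem height_eq_of_eqvGen_flip {S : Set (G.ReducedFace D₀)} (hS : S ⊆ G.flipFaces D₀ f₀)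
    {f : F} (hf : G.reducedFace D₀ f ∉ S) {D D' : G.homologyClass D₀}
    (h : Relation.EqvGen (G.Flip D₀ S) D D') : G.height f₀ D f = G.height f₀ D' f := by
  induction h with
  | rel A B hAB =>
    obtain ⟨x, hx, hd⟩ := hAB
    have hne : G.reducedFace D₀ f ≠ x := fun h => hf (h ▸ hx)
    simp [G.height_eq_add_indicator (hS hx) hd, indicator, hne]
  | refl => rfl
  | symm _ _ _ ih => exact ih.symm
  | trans _ _ _ _ _ ih ih' => exact ih.trans ih'

/-! ### Existence of flips, generation and minimality -/

variable [Fintype E]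

theorem exists_height_maximal (D₀ : EdgeOrientation E) (f₀ : F) :
    ∃ D : G.homologyClass D₀, ∀ D' : G.homologyClass D₀, G.height f₀ D' ≤ G.height f₀ D := by
  obtain ⟨_, h⟩ := G.exists_distribLattice f₀ (D₀ := D₀)
  have : Nonempty (G.homologyClass D₀) :=
    ⟨⟨D₀, by simp [homologyClass, Homologous, zero_mem]⟩⟩
  obtain ⟨D, hD⟩ := Finite.exists_le (fun D : G.homologyClass D₀ => D)
  exact ⟨D, fun D' => G.orientationLE_iff.1 ((h D' D).1 (hD D'))⟩

theorem exists_reducedBoundary_subset (D₀ : EdgeOrientation E) (x : G.ReducedFace D₀) :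
    ∃ D ∈ G.homologyClass D₀, G.reducedBoundary D₀ x ⊆ D.arcs := by
  induction x using Quot.ind with
  | mk f =>
  -- Heights are normalized at `f` itself: if a boundary dart were missing from `D`, reversing its
  -- edge would raise the height across it above the maximum.
  obtain ⟨D, hD⟩ := G.exists_height_maximal D₀ f
  refine ⟨D.1, D.2, fun d ⟨hd, hf⟩ => ?_⟩
  by_contra hdD
  have hd' := rev_mem_arcs_iff.2 hdD
  obtain ⟨D', hD'⟩ := G.exists_dir_ne_of_not_rigid D hd
  have h2 : Dart.rev d ∉ D'.1.arcs := fun h => hD' (h.trans hd'.symm)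
  have h1 := G.height_sub_left f D D' hd'
  have h3 := G.height_sub_eq_of_reducedFace_eq (f₀ := f) D D' hf
  have h4 : G.height f D' (G.left (Dart.rev d)) ≤ G.height f D (G.left (Dart.rev d)) := hD D' _
  simp only [h2, false_and, false_or, not_false_eq_true, true_and, Dart.rev_rev, height_base] at h1 h3
  omega

/-- If `D < D'`, some flip leads from `D` to an orientation that is still below `D'`. -/
theorem exists_flip_le {D D' : G.homologyClass D₀} (hle : G.height f₀ D ≤ G.height f₀ D')
    (hne : D ≠ D') :
    ∃ D'' : G.homologyClass D₀, G.Flip D₀ (G.flipFaces D₀ f₀) D D'' ∧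
      G.height f₀ D < G.height f₀ D'' ∧ G.height f₀ D'' ≤ G.height f₀ D' := by
  classical
  have := Fintype.ofFinite (G.homologyClass D₀)
  let g : F → ℤ := G.height f₀ D' - G.height f₀ D
  -- Tie-breaker among the faces that maximize `g`. Crossing a boundary dart that is missing from
  -- `D` weakly raises every summand, and strictly raises one since the edge is not rigid.
  let Φ : F → ℤ := fun f => ∑ A : G.homologyClass D₀, (G.height f₀ A f - G.height f₀ D f)
  have : Nonempty F := ⟨f₀⟩
  obtain ⟨m, hm⟩ := Finite.exists_max g
  obtain ⟨f, hf, hfmax⟩ := Finset.exists_max_image (Finset.univ.filter fun f => g f = g m) Φ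
    ⟨m, by simp⟩
  simp only [Finset.mem_filter, Finset.mem_univ, true_and] at hf hfmax
  have hpos : 0 < g f := by
    rw [hf]
    by_contra! hm0
    refine hne (G.height_injective f₀ (funext fun a => ?_))
    have h1 : G.height f₀ D a ≤ G.height f₀ D' a := hle a
    have h2 : G.height f₀ D' a - G.height f₀ D a ≤ g m := hm a
    omega
  have hfx : G.reducedFace D₀ f ≠ G.reducedFace D₀ f₀ := fun h => by
    have := G.height_sub_eq_of_reducedFace_eq (f₀ := f₀) D D' h
    simp only [height_base] at this
    simp only [g, Pi.sub_apply] at hpos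
    omega
  have hsub : G.reducedBoundary D₀ (G.reducedFace D₀ f) ⊆ D.1.arcs := by
    rintro d ⟨hd, hx⟩
    by_contra hdD
    have hd' := rev_mem_arcs_iff.2 hdD
    have hA : ∀ A : G.homologyClass D₀, G.height f₀ A f - G.height f₀ D f ≤
        G.height f₀ A (G.left (Dart.rev d)) - G.height f₀ D (G.left (Dart.rev d)) := fun A => by
      have h1 := G.height_sub_left f₀ D A hd'
      have h2 := G.height_sub_eq_of_reducedFace_eq (f₀ := f₀) D A hx
      rw [Dart.rev_rev] at h1
      omega
    obtain ⟨B, hB⟩ := G.exists_dir_ne_of_not_rigid D hd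
    have hB' : Dart.rev d ∉ B.1.arcs := fun h => hB (h.trans hd'.symm)
    have hlt : Φ f < Φ (G.left (Dart.rev d)) := by
      refine Finset.sum_lt_sum (fun A _ => hA A) ⟨B, Finset.mem_univ _, ?_⟩
      have h1 := G.height_sub_left f₀ D B hd'
      have h2 := G.height_sub_eq_of_reducedFace_eq (f₀ := f₀) D B hx
      simp only [hB', false_and, false_or, not_false_eq_true, true_and, Dart.rev_rev] at h1
      omega
    -- The summand of `D'` is `g`, so the face across still maximizes `g` while having larger `Φ`.
    refine absurd (hfmax (G.left (Dart.rev d)) (le_antisymm (hm _) ?_)) (not_le.2 hlt)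
    rw [← hf]
    exact hA D'
  obtain ⟨D'', hD''⟩ := G.exists_flip hfx hsub
  refine ⟨D'', ⟨_, hfx, G.diff_eq_reducedBoundary hD''⟩, ?_, fun a => ?_⟩
  · rw [hD'']
    refine lt_add_of_pos_right _ (lt_of_le_of_ne (G.indicator_nonneg _) fun h => ?_)
    simpa [indicator_reducedFace] using congrFun h f
  · have h1 : G.height f₀ D a ≤ G.height f₀ D' a := hle a
    rw [hD'']
    simp only [Pi.add_apply, indicator]
    split_ifs with h
    · have := G.height_sub_eq_of_reducedFace_eq (f₀ := f₀) D D' h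
      simp only [g, Pi.sub_apply] at hpos
      omega
    · simpa using h1

theorem reflTransGen_flip {D D' : G.homologyClass D₀} (hle : G.height f₀ D ≤ G.height f₀ D') :
    Relation.ReflTransGen (G.Flip D₀ (G.flipFaces D₀ f₀)) D D' := by
  have hwf : WellFounded fun A B : G.homologyClass D₀ => G.height f₀ B < G.height f₀ A :=
    haveI : Std.Irrefl fun A B : G.homologyClass D₀ => G.height f₀ B < G.height f₀ A :=
      ⟨fun _ => lt_irrefl _⟩
    haveI : IsTrans _ fun A B : G.homologyClass D₀ => G.height f₀ B < G.height f₀ A :=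
      ⟨fun _ _ _ h h' => h'.trans h⟩
    Finite.wellFounded_of_trans_of_irrefl _
  induction D using hwf.induction with
  | _ D ih =>
  by_cases hne : D = D'
  · rw [hne]
  · obtain ⟨D'', hflip, hlt, hle'⟩ := G.exists_flip_le hle hne
    exact .head hflip (ih D'' hlt hle')

variable (D₀ f₀) in
theorem generates_flipFaces : G.Generates D₀ f₀ (G.flipFaces D₀ f₀) := by
  intro D D'
  rw [orientationLE_iff]
  refine ⟨G.reflTransGen_flip, fun h => ?_⟩
  induction h with
  | refl => exact le_rfl
  | tail _ h ih =>
    obtain ⟨x, hx, hd⟩ := h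
    rw [G.height_eq_add_indicator hx hd]
    exact ih.trans (le_add_of_nonneg_right (G.indicator_nonneg x))

variable (D₀ f₀) in
-- Both orientations reach their join.
theorem connects_flipFaces : G.Connects D₀ (G.flipFaces D₀ f₀) := by
  intro D D'
  obtain ⟨D'', h⟩ := G.exists_height_eq_sup f₀ D D'
  have h1 := G.reflTransGen_flip (h ▸ le_sup_left : G.height f₀ D ≤ G.height f₀ D'')
  have h2 := G.reflTransGen_flip (h ▸ le_sup_right : G.height f₀ D' ≤ G.height f₀ D'')
  exact .trans _ _ _ (Relation.EqvGen.reflTransGen_le_eqvGen _ _ _ h1)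
    (.symm _ _ (Relation.EqvGen.reflTransGen_le_eqvGen _ _ _ h2))

/-- A set of labels that links the two ends of every flip contains all labels. -/
theorem flipFaces_subset {S : Set (G.ReducedFace D₀)} (hS : S ⊆ G.flipFaces D₀ f₀)
    (h : ∀ D D' : G.homologyClass D₀, G.height f₀ D ≤ G.height f₀ D' →
      Relation.EqvGen (G.Flip D₀ S) D D') : G.flipFaces D₀ f₀ ⊆ S := by
  intro x hx
  by_contra hxS
  obtain ⟨f, rfl⟩ := Quot.exists_rep x
  obtain ⟨D, hD, hsub⟩ := G.exists_reducedBoundary_subset D₀ (Quot.mk _ f)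
  obtain ⟨D', hD'⟩ := G.exists_flip (f₀ := f₀) (D := ⟨D, hD⟩) hx hsub
  have h1 := G.height_eq_of_eqvGen_flip hS (f := f) hxS 
    (h ⟨D, hD⟩ D' (hD' ▸ le_add_of_nonneg_right (G.indicator_nonneg _)))
  have h2 : G.indicator (Quot.mk _ f) f = 1 := G.indicator_reducedFace (D₀ := D₀) f
  rw [hD', Pi.add_apply, h2] at h1
  omega

end Height

end SurfaceMap

theorem proposition4p12 {V E F : Type*} [Fintype E] [Fintype F]
    (G : SurfaceMap V E F) (D₀ : EdgeOrientation E) :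
    (∀ x : G.ReducedFace D₀, ∃ D ∈ G.homologyClass D₀, G.reducedBoundary D₀ x ⊆ D.arcs) ∧
    ∀ f₀ : F,
      (∃ _ : DistribLattice (G.homologyClass D₀),
        ∀ D D' : G.homologyClass D₀, D ≤ D' ↔ G.OrientationLE f₀ D.1 D'.1) ∧
      Minimal (G.Generates D₀ f₀) (G.flipFaces D₀ f₀) ∧
      Minimal (G.Connects D₀) (G.flipFaces D₀ f₀) := by
  refine ⟨G.exists_reducedBoundary_subset D₀, fun f₀ => ⟨G.exists_distribLattice f₀,
    ⟨G.generates_flipFaces D₀ f₀, fun S hS hle => ?_⟩,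
    ⟨G.connects_flipFaces D₀ f₀, fun S hS hle => ?_⟩⟩⟩
  · exact G.flipFaces_subset hle fun D D' h =>
      Relation.EqvGen.reflTransGen_le_eqvGen _ _ _ ((hS D D').1 (G.orientationLE_iff.2 h))
  · exact G.flipFaces_subset hle fun D D' _ => hS D D'
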